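/- **Setting.** Let $J\subset\mathbb R^d$ be compact with nonempty interior, let $n_k\ge 2$ be integers and $0<r_k<1$ reals with $n_kr_k\le 1$ ($k\ge1$) and $r:=\inf_k r_k>0$. Let $D_k=\prod_{j=1}^k\{1,\dots,n_j\}$, $D=\bigcup_{k\ge0}D_k$ (finite words, $D_0$ consisting of the empty word $\emptyset$), and let $\{J_{\mathbf i}\}_{\mathbf i\in D}$ have the Moran structure: $J_\emptyset=J$; every $J_{\mathbf i}$ is the image of $J$ under a similarity of $\mathbb R^d$; for $k\ge1$ and $\mathbf i\in D_{k-1}$ the sets $J_{\mathbf i1},\dots,J_{\mathbf in_k}$ are subsets of $J_{\mathbf i}$ with pairwise disjoint interiors and $|J_{\mathbf ij}|/|J_{\mathbf i}|=r_k$, where $|\cdot|$ denotes the diameter. For $m\ge 0$ let $X_m=\{i_1\cdots i_k\in D: r_1\cdots r_k\le r^m<r_1\cdots r_{k-1}\}$ (so that $X_0=\{\emptyset\}$), and let $X=\bigcup_m X_m$ with root $o=\emptyset$. The vertical edges $\mathcal E_v$ join each $\mathbf u\in X_{m+1}$ to its unique prefix in $X_m$; the horizontal edges $\mathcal E_h$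 join distinct $\mathbf u,\mathbf v$ in the same $X_m$, $m\ge1$, with $J_{\mathbf u}\cap J_{\mathbf v}\ne\emptyset$. The graph $(X,\mathcal E)$ with $\mathcal E=\mathcal E_v\cup\mathcal E_h$ is the augmented tree. A horizontal component is a connected component of $(X,\mathcal E_h)$; each lies in a single $X_m$. Let $\Sigma_m$ be the set of suffixes $\mathbf s$ with $\mathbf u\mathbf s\in X_{m+1}$ for $\mathbf u\in X_m$ (it does not depend on $\mathbf u$). $(X,\mathcal E)$ is *rearrangeable* if the cardinalities of the horizontal components are finite and uniformly bounded, and for every horizontal component $T\subset X_m$ with $\#T=b$, the set $T\Sigma_m=\{\mathbf u\mathbf s\in X_{m+1}:\mathbf u\in T,\mathbf s\in\Sigma_m\}$ is the disjoint union of $b$ groups, each of which is a union of horizontal components and has exactly $\#\Sigma_m$ elements. With the graph distance $d_{\mathcal E}$ and $|x|=d_{\mathcal E}(o,x)$, let $|x\wedge y|=\frac12(|x|+|y|-d_{\mathcal E}(x,y))$. The connected graph is hyperbolic with constant $\delta>0$ if $|x\wedge y|\ge\min\{|x\wedge z|,|z\wedge y|\}-\delta$ for all $x,y,z\in X$. A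 number $a>0$ is admissible if $e^{\delta a}-1<\sqrt2-1$ for some such $\delta$. For admissible $a$ put $\rho_a(x,y)=e^{-a|x\wedge y|}$ for $x\ne y$ and $\rho_a(x,x)=0$; $\rho_a$ is equivalent (up to a multiplicative constant) to a metric on $X$, namely the chain metric $\inf\sum_i\rho_a(x_i,x_{i+1})$ over finite chains from $x$ to $y$. The hyperbolic boundary is $\partial(X,\mathcal E)=\hat X\setminus X$, where $\hat X$ is the completion of $X$ in this metric, with the topology induced from $\hat X$. **Corollary 4.5.** If the augmented tree $(X,\mathcal E)$ is rearrangeable, then $(X,\mathcal E)$ is hyperbolic, and for every admissible $a$ the hyperbolic boundary $(\partial(X,\mathcal E),\rho_a)$ is totally disconnected. -/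

import Mathlib

/-! ## Rooted graphs, Gromov hyperbolicity and the hyperbolic boundary -/

/-- The Gromov product `|x ∧ y| = (|x| + |y| - d(x, y)) / 2` of a graph with root `o`, where `d` is
the graph distance and `|x| = d(o, x)`. -/
noncomputable def gromovProduct {V : Type*} (G : SimpleGraph V) (o x y : V) : ℝ :=
  (1 / 2 : ℝ) * ((G.dist o x : ℝ) + (G.dist o y : ℝ) - (G.dist x y : ℝ))

/-- The connected graph `G` is hyperbolic with respect to the root `o`, with constant `δ`. -/
def IsHyperbolicWith {V : Type*} (G : SimpleGraph V) (o : V) (δ : ℝ) : Prop :=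
  G.Connected ∧
    ∀ x y z : V,
      min (gromovProduct G o x z) (gromovProduct G o z y) - δ ≤ gromovProduct G o x y

/-- `a > 0` is an admissible parameter: `exp (δ a) - 1 < √2 - 1` for a hyperbolicity constant
`δ > 0` of the graph. -/
def IsAdmissible {V : Type*} (G : SimpleGraph V) (o : V) (a : ℝ) : Prop :=
  0 < a ∧ ∃ δ : ℝ, 0 < δ ∧ IsHyperbolicWith G o δ ∧ Real.exp (δ * a) - 1 < Real.sqrt 2 - 1

open Classical in
/-- The hyperbolic "metric" `ρ_a(x, y) = exp (-a |x ∧ y|)` for `x ≠ y`, and `ρ_a(x, x) = 0`. -/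
noncomputable def rho {V : Type*} (G : SimpleGraph V) (o : V) (a : ℝ) (x y : V) : ℝ :=
  if x = y then 0 else Real.exp (-a * gromovProduct G o x y)

theorem rho_nonneg {V : Type*} (G : SimpleGraph V) (o : V) (a : ℝ) (x y : V) :
    0 ≤ rho G o a x y := by
  unfold rho; split_ifs
  · exact le_rfl
  · exact (Real.exp_pos _).le

theorem rho_self {V : Type*} (G : SimpleGraph V) (o : V) (a : ℝ) (x : V) :
    rho G o a x x = 0 := by
  simp [rho]

theorem rho_comm {V : Type*} (G : SimpleGraph V) (o : V) (a : ℝ) (x y : V) :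
    rho G o a x y = rho G o a y x := by
  have h : gromovProduct G o x y = gromovProduct G o y x := by
    unfold gromovProduct
    rw [G.dist_comm (u := x) (v := y), add_comm (G.dist o x : ℝ)]
  unfold rho
  rw [h]
  by_cases hxy : x = y
  · rw [if_pos hxy, if_pos hxy.symm]
  · rw [if_neg hxy, if_neg (Ne.symm hxy)]

/-- The vertex set of `G`, regarded as a metric space with parameter `a`. -/
def HypSpace {V : Type*} (_G : SimpleGraph V) (_o : V) (_a : ℝ) : Type _ := V

/-- `ρ_a` satisfies the triangle inequality only up to a constant. As usual, it is replaced by the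
associated chain metric `inf ∑ ρ_a(x_i, x_{i+1})`, the infimum over finite chains from `x` to `y`,
which is the largest (pseudo)metric below `ρ_a`. For an admissible `a` it is equivalent to `ρ_a`,
see `dist_le_rho` and `rho_le_two_mul_dist` below. -/
noncomputable instance instPseudoMetricSpaceHypSpace {V : Type*} (G : SimpleGraph V) (o : V)
    (a : ℝ) : PseudoMetricSpace (HypSpace G o a) :=
  PseudoMetricSpace.ofPreNNDist (X := V) (fun x y => Real.toNNReal (rho G o a x y))
    (fun x => by simp [rho_self]) (fun x y => by rw [rho_comm])

theorem dist_le_rho {V : Type*} (G : SimpleGraph V) (o : V) (a : ℝ) (x y : HypSpace G o a) :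
    dist x y ≤ rho G o a x y := by
  have h := PseudoMetricSpace.dist_ofPreNNDist_le (X := V)
    (fun x y => Real.toNNReal (rho G o a x y))
    (fun x => by simp [rho_self]) (fun x y => by rw [rho_comm]) x y
  rwa [Real.coe_toNNReal _ (rho_nonneg G o a x y)] at h

theorem rho_le_mul_max {V : Type*} (G : SimpleGraph V) (o : V) {a δ : ℝ} (ha : 0 < a)
    (hδ : 0 < δ) (h : IsHyperbolicWith G o δ) (x y z : V) :
    rho G o a x y ≤ Real.exp (δ * a) * max (rho G o a x z) (rho G o a z y) := by
  have h1 : 1 ≤ Real.exp (δ * a) := Real.one_le_exp (by positivity)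
  have hm : ∀ t s : ℝ, 0 ≤ t → t ≤ s → t ≤ Real.exp (δ * a) * s := fun t s ht hts =>
    hts.trans (le_mul_of_one_le_left (ht.trans hts) h1)
  by_cases hxy : x = y
  · subst hxy
    rw [rho_self]
    exact mul_nonneg (Real.exp_pos _).le (le_max_of_le_left (rho_nonneg G o a x z))
  by_cases hxz : x = z
  · subst hxz
    exact hm _ _ (rho_nonneg G o a x y) (le_max_right _ _)
  by_cases hzy : z = y
  · subst hzy
    exact hm _ _ (rho_nonneg G o a x z) (le_max_left _ _)
  have hh := h.2 x y z
  simp only [rho, hxy, hxz, hzy, if_false]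
  rcases le_total (gromovProduct G o x z) (gromovProduct G o z y) with hle | hle
  · rw [min_eq_left hle] at hh
    refine le_trans ?_ (mul_le_mul_of_nonneg_left (le_max_left _ _) (Real.exp_pos _).le)
    rw [← Real.exp_add]
    apply Real.exp_le_exp.2
    nlinarith
  · rw [min_eq_right hle] at hh
    refine le_trans ?_ (mul_le_mul_of_nonneg_left (le_max_right _ _) (Real.exp_pos _).le)
    rw [← Real.exp_add]
    apply Real.exp_le_exp.2
    nlinarith

theorem rho_le_two_mul_dist {V : Type*} (G : SimpleGraph V) (o : V) {a : ℝ}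
    (ha : IsAdmissible G o a) (x y : HypSpace G o a) :
    rho G o a x y ≤ 2 * dist x y := by
  obtain ⟨ha, δ, hδ, hyp, hlt⟩ := ha
  have hlt' : Real.exp (δ * a) ≤ Real.sqrt 2 := by linarith
  have hpos := Real.exp_pos (δ * a)
  have h1 : 1 ≤ Real.exp (δ * a) := Real.one_le_exp (by positivity)
  have hsq : Real.exp (δ * a) * Real.exp (δ * a) ≤ 2 := by
    calc _ ≤ Real.sqrt 2 * Real.sqrt 2 := mul_le_mul hlt' hlt' hpos.le (Real.sqrt_nonneg 2)
      _ = 2 := Real.mul_self_sqrt (by norm_num)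
  have h := PseudoMetricSpace.le_two_mul_dist_ofPreNNDist (X := V)
    (fun x y => Real.toNNReal (rho G o a x y))
    (fun x => by simp [rho_self]) (fun x y => by rw [rho_comm]) (by
      intro x₁ x₂ x₃ x₄
      rw [← NNReal.coe_le_coe]
      push_cast
      simp only [Real.coe_toNNReal _ (rho_nonneg G o a _ _)]
      set M := max (rho G o a x₁ x₂) (max (rho G o a x₂ x₃) (rho G o a x₃ x₄)) with hM
      have hM0 : 0 ≤ M := le_max_of_le_left (rho_nonneg G o a x₁ x₂)
      have e1 := rho_le_mul_max G o ha hδ hyp x₂ x₄ x₃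
      have e2 := rho_le_mul_max G o ha hδ hyp x₁ x₄ x₂
      have f1 : max (rho G o a x₂ x₃) (rho G o a x₃ x₄) ≤ M := le_max_right _ _
      have f2 : rho G o a x₁ x₂ ≤ Real.exp (δ * a) * M :=
        (le_max_left _ _).trans (le_mul_of_one_le_left hM0 h1)
      have f3 : rho G o a x₂ x₄ ≤ Real.exp (δ * a) * M :=
        e1.trans (mul_le_mul_of_nonneg_left f1 hpos.le)
      calc rho G o a x₁ x₄
          ≤ Real.exp (δ * a) * (Real.exp (δ * a) * M) :=
            e2.trans (mul_le_mul_of_nonneg_left (max_le f2 f3) hpos.le)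
        _ = (Real.exp (δ * a) * Real.exp (δ * a)) * M := by ring
        _ ≤ 2 * M := mul_le_mul_of_nonneg_right hsq hM0) x y
  rwa [Real.coe_toNNReal _ (rho_nonneg G o a x y)] at h

/-- The hyperbolic boundary `∂X = X̂ \ X`, where `X̂` is the completion of `X` under the hyperbolic
metric with parameter `a`. It carries the subspace topology of `X̂`. -/
def hyperbolicBoundary {V : Type*} (G : SimpleGraph V) (o : V) (a : ℝ) :
    Set (UniformSpace.Completion (HypSpace G o a)) :=
  (Set.range ((↑) : HypSpace G o a → UniformSpace.Completion (HypSpace G o a)))ᶜ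

/-! ## Moran structures -/

/-- The finite words `i_1 ⋯ i_k` over the alphabets of sizes `n 0, n 1, …`. Everything is indexed
from `0`: the letter in position `j` is an element of `{0, …, n j - 1}`. -/
def IsWord (n : ℕ → ℕ) (w : List ℕ) : Prop :=
  ∀ (j : ℕ) (h : j < w.length), w[j] < n j

/-- A collection `{J_w}` (here `basic w`, for words `w`) of subsets of `J ⊆ ℝ^d` that has the Moran
structure. `n k`, `r k` are the number of pieces and the ratio for passing from words of length `k`
to words of length `k + 1`. The values of `basic` at lists that are not words are irrelevant. -/
structure MoranStructure (d : ℕ) where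
  J : Set (EuclideanSpace ℝ (Fin d))
  isCompact_J : IsCompact J
  interior_J_nonempty : (interior J).Nonempty
  n : ℕ → ℕ
  r : ℕ → ℝ
  two_le_n : ∀ k, 2 ≤ n k
  r_pos : ∀ k, 0 < r k
  r_lt_one : ∀ k, r k < 1
  n_mul_r_le_one : ∀ k, (n k : ℝ) * r k ≤ 1
  basic : List ℕ → Set (EuclideanSpace ℝ (Fin d))
  basic_nil : basic [] = J
  similar : ∀ w, IsWord n w →
    ∃ S : EuclideanSpace ℝ (Fin d) →ᵈ EuclideanSpace ℝ (Fin d), basic w = S '' J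
  basic_subset : ∀ w, IsWord n w → ∀ i < n w.length, basic (w ++ [i]) ⊆ basic w
  disjoint_interior : ∀ w, IsWord n w → ∀ i < n w.length, ∀ j < n w.length, i ≠ j →
    Disjoint (interior (basic (w ++ [i]))) (interior (basic (w ++ [j])))
  diam_ratio : ∀ w, IsWord n w → ∀ i < n w.length,
    Metric.diam (basic (w ++ [i])) / Metric.diam (basic w) = r w.length

namespace MoranStructure

variable {d : ℕ} (M : MoranStructure d)

/-- `r = inf_k r_k`. -/
noncomputable def rInf : ℝ := ⨅ k, M.r k

/-- The product `r_1 ⋯ r_k` of the first `k` ratios. -/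
noncomputable def ratioProd (k : ℕ) : ℝ := ∏ j ∈ Finset.range k, M.r j

/-- The level `X_m`: the words `i_1 ⋯ i_k` with `r_1 ⋯ r_k ≤ r ^ m < r_1 ⋯ r_{k-1}`, where the
second inequality is void for the empty word (so that `X_0` consists of the empty word). -/
def level (m : ℕ) : Set (List ℕ) :=
  {w | IsWord M.n w ∧ M.ratioProd w.length ≤ M.rInf ^ m ∧
    ∀ k, k + 1 = w.length → M.rInf ^ m < M.ratioProd k}

/-- The vertex set `X = ⋃ X_m`. -/
def Vertex : Type := {w : List ℕ // ∃ m, w ∈ M.level m}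

/-- The root `o`: the empty word. -/
def root : M.Vertex := ⟨[], 0, by simp [level, IsWord, ratioProd]⟩

/-- `v` is the first ancestor of `u`: `u = v v'` with `u ∈ X_{m+1}`, `v ∈ X_m`. -/
def IsParent (v u : M.Vertex) : Prop :=
  ∃ m, v.1 ∈ M.level m ∧ u.1 ∈ M.level (m + 1) ∧ ∃ s : List ℕ, u.1 = v.1 ++ s

/-- The graph of the horizontal edges: distinct words in a common `X_m`, `m > 0`, whose basic sets
intersect. -/
def horizontalGraph : SimpleGraph M.Vertex where
  Adj u v := u ≠ v ∧ ∃ m, 0 < m ∧ u.1 ∈ M.level m ∧ v.1 ∈ M.level m ∧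
    (M.basic u.1 ∩ M.basic v.1).Nonempty
  symm := ⟨fun u v ⟨hne, m, hm, hu, hv, h⟩ => ⟨hne.symm, m, hm, hv, hu, by rwa [Set.inter_comm]⟩⟩
  loopless := ⟨fun _ h => h.1 rfl⟩

/-- The graph of the vertical edges: the pairs of a vertex and its first ancestor. -/
def verticalGraph : SimpleGraph M.Vertex := SimpleGraph.fromRel M.IsParent

/-- The augmented tree `(X, 𝓔)`, `𝓔 = 𝓔_v ∪ 𝓔_h`. -/
def augmentedTree : SimpleGraph M.Vertex := M.verticalGraph ⊔ M.horizontalGraph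

/-- The set `Σ_m` of suffixes that lead from words of `X_m` to words of `X_{m+1}`. -/
def suffixes (m : ℕ) : Set (List ℕ) :=
  {s | ∃ u ∈ M.level m, u ++ s ∈ M.level (m + 1)}

/-- The offsprings `T Σ_m` in `X_{m+1}` of a set `T ⊆ X_m`. -/
def offspring (m : ℕ) (T : Set M.Vertex) : Set M.Vertex :=
  {u | u.1 ∈ M.level (m + 1) ∧ ∃ v ∈ T, ∃ s ∈ M.suffixes m, u.1 = v.1 ++ s}

/-- The augmented tree is rearrangeable: the horizontal connected components have uniformly bounded
(finite) cardinality, and for every horizontal component `T`, lying in `X_m` say, the set `T Σ_m` is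
decomposed into `#T` groups, each of which is a union of horizontal components and has `#Σ_m`
elements in total. (Horizontal components are connected components of the horizontal graph; each of
them lies in a single level.) -/
def Rearrangeable : Prop :=
  (∃ B : ℕ, ∀ T : M.horizontalGraph.ConnectedComponent, T.supp.Finite ∧ T.supp.ncard ≤ B) ∧
  ∀ (m : ℕ) (T : M.horizontalGraph.ConnectedComponent), (∀ u ∈ T.supp, u.1 ∈ M.level m) →
    ∃ Λ : Fin T.supp.ncard → Set M.horizontalGraph.ConnectedComponent,
      Pairwise (fun s t => Disjoint (Λ s) (Λ t)) ∧
      M.offspring m T.supp = ⋃ s, ⋃ Z ∈ Λ s, Z.supp ∧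
      ∀ s, (⋃ Z ∈ Λ s, Z.supp).ncard = (M.suffixes m).ncard

end MoranStructure

/-! Let `B` bound the sizes of the horizontal components. `Related m` says that the level-`m`
ancestors of two vertices share a component. It is transitive and persists when `m` decreases,
because horizontal neighbours have parents in one component. For the largest such `m`, the Gromov
product lies in `[m - B/2, m]`: every walk must descend to a level where the ancestors are related
(`exists_related_of_walk`), and crossing a component costs at most `B` steps (`Related.dist_le`).
Transitivity then yields hyperbolicity.

For the boundary, classes of `Related m` are a definite distance apart (`le_dist_of_not_related`),
while their diameters tend to `0` as `m` grows (`Related.hypSpace_dist_le`). Two boundary points are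
therefore separated by disjoint open sets covering the completion.

A Moran structure fits this scheme: each level consists of all words of one length
(`exists_isLevelLength`), and nested basic sets keep intersecting when words are truncated. -/

/-- The data of a rooted tree, given by its `level` and `parent` functions, together with a graph of
horizontal edges that is compatible with passing to parents. -/
structure TreeAugmentation (V : Type*) where
  root : V
  level : V → ℕ
  parent : V → V
  horizontal : SimpleGraph V
  level_root : level root = 0
  eq_root_of_level : ∀ x, level x = 0 → x = root
  level_parent : ∀ x, level (parent x) = level x - 1
  level_eq_of_adj : ∀ x y, horizontal.Adj x y → level x = level y
  reachable_parent_of_adj : ∀ x y, horizontal.Adj x y →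
    horizontal.Reachable (parent x) (parent y)

/-! ### Ancestors, related vertices and walks. -/

namespace TreeAugmentation

variable {V : Type*} (A : TreeAugmentation V)

/-- The graph consisting of the tree edges and the horizontal edges. -/
def graph : SimpleGraph V :=
  SimpleGraph.fromRel (fun x y => x = A.parent y) ⊔ A.horizontal

/-- The ancestor of `x` at level `m`, for `m ≤ A.level x`. -/
def ancestor (m : ℕ) (x : V) : V := A.parent^[A.level x - m] x

/-- The ancestors of `x` and `y` at level `m` exist and lie in the same horizontal component. -/
def Related (m : ℕ) (x y : V) : Prop :=
  m ≤ A.level x ∧ m ≤ A.level y ∧ A.horizontal.Reachable (A.ancestor m x) (A.ancestor m y)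

theorem level_iterate_parent (k : ℕ) (x : V) : A.level (A.parent^[k] x) = A.level x - k := by
  induction k with
  | zero => rfl
  | succ k ih => rw [Function.iterate_succ_apply', level_parent, ih]; omega

theorem ancestor_zero (x : V) : A.ancestor 0 x = A.root :=
  A.eq_root_of_level _ (by rw [ancestor, level_iterate_parent]; omega)

theorem ancestor_level (x : V) : A.ancestor (A.level x) x = x := by simp [ancestor]

theorem parent_ancestor {m : ℕ} {x : V} (h : m + 1 ≤ A.level x) :
    A.parent (A.ancestor (m + 1) x) = A.ancestor m x := by
  rw [ancestor, ancestor, ← Function.iterate_succ_apply' A.parent]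
  congr 2
  omega

theorem ancestor_parent {m : ℕ} {x : V} (h : m + 1 ≤ A.level x) :
    A.ancestor m (A.parent x) = A.ancestor m x := by
  rw [ancestor, ancestor, level_parent, ← Function.iterate_succ_apply A.parent]
  congr 2
  omega

theorem reachable_parent {x y : V} (h : A.horizontal.Reachable x y) :
    A.horizontal.Reachable (A.parent x) (A.parent y) := by
  obtain ⟨w⟩ := h
  induction w with
  | nil => rfl
  | cons h _ ih => exact (A.reachable_parent_of_adj _ _ h).trans ih

theorem reachable_iterate_parent (k : ℕ) {x y : V} (h : A.horizontal.Reachable x y) :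
    A.horizontal.Reachable (A.parent^[k] x) (A.parent^[k] y) := by
  induction k with
  | zero => exact h
  | succ k ih =>
    rw [Function.iterate_succ_apply', Function.iterate_succ_apply']
    exact A.reachable_parent ih

variable {A}

theorem Related.zero (x y : V) : A.Related 0 x y :=
  ⟨Nat.zero_le _, Nat.zero_le _, by rw [ancestor_zero, ancestor_zero]⟩

theorem Related.symm {m : ℕ} {x y : V} (h : A.Related m x y) : A.Related m y x :=
  ⟨h.2.1, h.1, h.2.2.symm⟩

theorem Related.trans {m : ℕ} {x y z : V} (h : A.Related m x y) (h' : A.Related m y z) :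
    A.Related m x z :=
  ⟨h.1, h'.2.1, h.2.2.trans h'.2.2⟩

theorem Related.refl {m : ℕ} {x : V} (h : m ≤ A.level x) : A.Related m x x := ⟨h, h, by rfl⟩

/-- Taking parents maps each horizontal component into a single component one level closer to the
root. -/
theorem Related.mono {m k : ℕ} {x y : V} (h : A.Related m x y) (hk : k ≤ m) :
    A.Related k x y := by
  induction m, hk using Nat.le_induction with
  | base => exact h
  | succ m _ ih =>
    refine ih ⟨by have := h.1; omega, by have := h.2.1; omega, ?_⟩
    rw [← A.parent_ancestor h.1, ← A.parent_ancestor h.2.1]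
    exact A.reachable_parent h.2.2

theorem Related.of_adj {m : ℕ} {x y : V} (h : A.horizontal.Adj x y) (hm : m ≤ A.level x) :
    A.Related m x y := by
  have hl := A.level_eq_of_adj x y h
  refine ⟨hm, hl ▸ hm, ?_⟩
  rw [ancestor, ancestor, hl]
  exact A.reachable_iterate_parent _ h.reachable

theorem Related.parent {m : ℕ} {x : V} (h : m + 1 ≤ A.level x) : A.Related m x (A.parent x) :=
  ⟨by omega, by rw [level_parent]; omega, by rw [A.ancestor_parent h]⟩

/-- A walk from `x` to `y` has to climb down to a level where the ancestors of `x` and `y` lie in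
the same horizontal component. -/
theorem exists_related_of_walk {x y : V} (w : A.graph.Walk x y) :
    ∃ m, A.Related m x y ∧ A.level x + A.level y ≤ w.length + 2 * m := by
  induction w with
  | nil => exact ⟨_, .refl le_rfl, by simp; omega⟩
  | @cons x z y h w ih =>
    obtain ⟨m, hm, hlen⟩ := ih
    rw [SimpleGraph.Walk.length_cons]
    have hmz := hm.1
    rcases h with ⟨-, h | h⟩ | h
    · have hl := A.level_parent z
      rw [← h] at hl
      by_cases hlt : m + 1 ≤ A.level z
      · exact ⟨m, (h ▸ Related.parent hlt : A.Related m z x).symm.trans hm, by omega⟩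
      · rcases Nat.eq_zero_or_pos (A.level z) with h0 | h0
        · refine ⟨0, .zero _ _, by omega⟩
        -- Here `m` is the level of `z`, one more than that of `x`. Lowering `m` by one costs 2,
        -- paid for by the extra edge and the smaller level of `x`.
        · obtain ⟨k, rfl⟩ : ∃ k, m = k + 1 := ⟨m - 1, by omega⟩
          exact ⟨k, (h ▸ Related.parent hmz : A.Related k z x).symm.trans
            (hm.mono (Nat.le_succ k)), by omega⟩
    · have hl := A.level_parent x
      rw [← h] at hl
      by_cases hlt : m + 1 ≤ A.level x
      · exact ⟨m, (h ▸ Related.parent hlt : A.Related m x z).trans hm, by omega⟩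
      -- By truncated subtraction, only `A.level x = 0` is left.
      · exact ⟨0, .zero _ _, by omega⟩
    · have hl := A.level_eq_of_adj x z h
      exact ⟨m, (Related.of_adj h (hl ▸ hmz)).trans hm, by omega⟩

theorem exists_walk_iterate_parent (k : ℕ) (x : V) :
    ∃ w : A.graph.Walk x (A.parent^[k] x), w.length ≤ k := by
  induction k with
  | zero => exact ⟨.nil, le_rfl⟩
  | succ k ih =>
    obtain ⟨w, hw⟩ := ih
    rw [Function.iterate_succ_apply']
    -- Equality occurs only at the root, which is its own parent; the walk then stays put.
    by_cases h : A.parent^[k] x = A.parent (A.parent^[k] x)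
    · rw [← h]; exact ⟨w, by omega⟩
    · have hadj : A.graph.Adj (A.parent^[k] x) (A.parent (A.parent^[k] x)) :=
        Or.inl ⟨h, Or.inr rfl⟩
      exact ⟨w.concat hadj, by rw [SimpleGraph.Walk.length_concat]; omega⟩

theorem exists_walk_ancestor (m : ℕ) (x : V) :
    ∃ w : A.graph.Walk x (A.ancestor m x), w.length ≤ A.level x - m :=
  exists_walk_iterate_parent _ x

theorem connected_graph : A.graph.Connected := by
  have h : ∀ x, A.graph.Reachable x A.root := fun x => by
    obtain ⟨w, -⟩ := exists_walk_ancestor (A := A) 0 x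
    rw [ancestor_zero] at w
    exact ⟨w⟩
  have : Nonempty V := ⟨A.root⟩
  exact ⟨fun x y => (h x).trans (h y).symm⟩

theorem dist_root (x : V) : A.graph.dist A.root x = A.level x := by
  apply le_antisymm
  · obtain ⟨w, hw⟩ := exists_walk_ancestor (A := A) 0 x
    have h := SimpleGraph.dist_le w
    rw [SimpleGraph.dist_comm] at h
    rw [← A.ancestor_zero x]
    omega
  · obtain ⟨w, hw⟩ := connected_graph.exists_walk_length_eq_dist (G := A.graph) A.root x
    obtain ⟨m, hm, hlen⟩ := exists_related_of_walk w
    have := hm.1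
    have := A.level_root
    omega

end TreeAugmentation

/-! ### Bounded components: Gromov products, hyperbolicity and the boundary. -/

/-- Reachable vertices of a graph with uniformly bounded components have uniformly bounded
distance. -/
theorem SimpleGraph.Reachable.exists_walk_length_le {V : Type*} {H : SimpleGraph V} {B : ℕ}
    (hB : ∀ T : H.ConnectedComponent, T.supp.Finite ∧ T.supp.ncard ≤ B) {x y : V}
    (h : H.Reachable x y) : ∃ w : H.Walk x y, w.length ≤ B := by
  classical
  -- A path visits distinct vertices of one component, so its length is less than the component's
  -- size.
  obtain ⟨w, hw⟩ := h.exists_isPath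
  refine ⟨w, ?_⟩
  obtain ⟨hfin, hcard⟩ := hB (H.connectedComponentMk x)
  have hsub : (w.support.toFinset : Set V) ⊆ (H.connectedComponentMk x).supp := by
    intro z hz
    rw [List.coe_toFinset] at hz
    exact SimpleGraph.ConnectedComponent.eq.2 ⟨(w.takeUntil z hz).reverse⟩
  have h1 := Set.ncard_le_ncard hsub hfin
  rw [Set.ncard_coe_finset, List.toFinset_card_of_nodup hw.support_nodup,
    SimpleGraph.Walk.length_support] at h1
  omega

namespace TreeAugmentation

variable {V : Type*} {A : TreeAugmentation V}

theorem Related.dist_le {B : ℕ}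
    (hB : ∀ T : A.horizontal.ConnectedComponent, T.supp.Finite ∧ T.supp.ncard ≤ B)
    {m : ℕ} {x y : V} (h : A.Related m x y) :
    A.graph.dist x y + 2 * m ≤ A.level x + A.level y + B := by
  obtain ⟨hx, hy, hxy⟩ := h
  obtain ⟨w, hw⟩ := hxy.exists_walk_length_le hB
  obtain ⟨u, hu⟩ := exists_walk_ancestor (A := A) m x
  obtain ⟨v, hv⟩ := exists_walk_ancestor (A := A) m y
  have hle : A.horizontal ≤ A.graph := le_sup_right
  have := SimpleGraph.dist_le ((u.append (w.mapLe hle)).append v.reverse)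
  simp only [SimpleGraph.Walk.length_append, SimpleGraph.Walk.length_reverse,
    SimpleGraph.Walk.length_map, SimpleGraph.Walk.mapLe] at this
  omega

theorem Related.le_gromovProduct {B : ℕ}
    (hB : ∀ T : A.horizontal.ConnectedComponent, T.supp.Finite ∧ T.supp.ncard ≤ B)
    {m : ℕ} {x y : V} (h : A.Related m x y) :
    (m : ℝ) - B / 2 ≤ gromovProduct A.graph A.root x y := by
  have h1 : (A.graph.dist x y + 2 * m : ℝ) ≤ A.level x + A.level y + B := by
    exact_mod_cast h.dist_le hB
  rw [gromovProduct, dist_root, dist_root]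
  linarith

theorem exists_related_gromovProduct_le (x y : V) :
    ∃ m, A.Related m x y ∧ gromovProduct A.graph A.root x y ≤ m := by
  obtain ⟨w, hw⟩ := connected_graph.exists_walk_length_eq_dist (G := A.graph) x y
  obtain ⟨m, hm, hlen⟩ := exists_related_of_walk w
  refine ⟨m, hm, ?_⟩
  rw [hw] at hlen
  have h1 : (A.level x + A.level y : ℝ) ≤ A.graph.dist x y + 2 * m := by exact_mod_cast hlen
  rw [gromovProduct, dist_root, dist_root]
  linarith

theorem gromovProduct_le_of_not_related {m : ℕ} {x y : V} (h : ¬ A.Related m x y) :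
    gromovProduct A.graph A.root x y ≤ m := by
  obtain ⟨k, hk, hle⟩ := exists_related_gromovProduct_le (A := A) x y
  have hkm : k ≤ m := by
    by_contra hlt
    exact h (hk.mono (by omega))
  exact hle.trans (by exact_mod_cast hkm)

/-- A tree with horizontal edges is hyperbolic if the horizontal components are uniformly
bounded. -/
theorem isHyperbolicWith {B : ℕ}
    (hB : ∀ T : A.horizontal.ConnectedComponent, T.supp.Finite ∧ T.supp.ncard ≤ B) :
    IsHyperbolicWith A.graph A.root ((B : ℝ) / 2 + 1) := by
  refine ⟨connected_graph, fun x y z => ?_⟩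
  obtain ⟨m, hm, hxz⟩ := exists_related_gromovProduct_le (A := A) x z
  obtain ⟨k, hk, hzy⟩ := exists_related_gromovProduct_le (A := A) z y
  -- Both pairs are related at level `min m k`, hence so are `x` and `y`. The loss is `B / 2`; the
  -- extra 1 makes the constant visibly positive.
  have h := ((hm.mono (min_le_left m k)).trans (hk.mono (min_le_right m k))).le_gromovProduct hB
  have hmin := min_le_min hxz hzy
  rw [Nat.cast_min] at h
  linarith

theorem _root_.rho_of_ne {V : Type*} (G : SimpleGraph V) (o : V) (a : ℝ) {x y : V} (h : x ≠ y) :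
    rho G o a x y = Real.exp (-a * gromovProduct G o x y) := if_neg h

/-- The factor 1/2 is the price of the chain metric. A vertex of level below `m` is related at `m`
to nothing, so it is isolated at this scale. -/
theorem le_dist_of_not_related {a : ℝ} (ha : IsAdmissible A.graph A.root a) {m : ℕ}
    {x y : HypSpace A.graph A.root a} (hne : x ≠ y) (h : ¬ A.Related m x y) :
    Real.exp (-a * m) / 2 ≤ dist x y := by
  have h1 := rho_le_two_mul_dist A.graph A.root ha x y
  have h2 : Real.exp (-a * m) ≤ rho A.graph A.root a x y := by
    refine le_of_le_of_eq (Real.exp_le_exp.2 ?_) (rho_of_ne A.graph A.root a hne).symm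
    have := mul_le_mul_of_nonneg_left (gromovProduct_le_of_not_related h) ha.1.le
    linarith
  linarith

theorem Related.hypSpace_dist_le {B : ℕ}
    (hB : ∀ T : A.horizontal.ConnectedComponent, T.supp.Finite ∧ T.supp.ncard ≤ B)
    {a : ℝ} (ha : 0 < a) {m : ℕ} {x y : HypSpace A.graph A.root a} (h : A.Related m x y) :
    dist x y ≤ Real.exp (-a * (m - B / 2)) := by
  refine (dist_le_rho A.graph A.root a x y).trans ?_
  by_cases hxy : x = y
  · subst hxy
    exact (rho_self A.graph A.root a x).trans_le (Real.exp_pos _).le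
  · refine (rho_of_ne A.graph A.root a hxy).trans_le (Real.exp_le_exp.2 ?_)
    have := mul_le_mul_of_nonneg_left (h.le_gromovProduct hB) ha.le
    linarith

/-- Vertices close to a boundary point have a high level. -/
theorem le_level_of_dist_lt {a : ℝ} (ha : IsAdmissible A.graph A.root a)
    {ξ : UniformSpace.Completion (HypSpace A.graph A.root a)}
    (hξ : ξ ∈ hyperbolicBoundary A.graph A.root a) {m : ℕ} {x : HypSpace A.graph A.root a}
    (hx : dist ξ x < Real.exp (-a * m) / 4) : m ≤ A.level x := by
  by_contra hlt
  -- As `ξ` is not a vertex, some vertex `y` is strictly closer to it than `x`, hence different from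
  -- `x`; if `x` had level below `m`, the separation bound would fail.
  have hpos : 0 < dist ξ x := dist_pos.2 fun h => hξ ⟨x, h.symm⟩
  obtain ⟨y, hy⟩ := Metric.mem_closure_range_iff.1
    (UniformSpace.Completion.denseRange_coe ξ) _ hpos
  have hne : x ≠ y := by rintro rfl; exact lt_irrefl _ hy
  have h1 := le_dist_of_not_related ha hne (m := m) fun h => hlt h.1
  rw [← UniformSpace.Completion.dist_eq] at h1
  have h2 := dist_triangle_left (x : UniformSpace.Completion (HypSpace A.graph A.root a)) y ξ
  linarith

/-- The hyperbolic boundary of a tree with horizontal edges is totally disconnected if the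
horizontal components are uniformly bounded. -/
theorem isTotallyDisconnected_hyperbolicBoundary {B : ℕ}
    (hB : ∀ T : A.horizontal.ConnectedComponent, T.supp.Finite ∧ T.supp.ncard ≤ B)
    {a : ℝ} (ha : IsAdmissible A.graph A.root a) :
    IsTotallyDisconnected (hyperbolicBoundary A.graph A.root a) := by
  intro t ht hconn ξ hξ η hη
  by_contra hne
  have hd : 0 < dist ξ η := dist_pos.2 hne
  obtain ⟨m, hm⟩ : ∃ m : ℕ, Real.exp (-a * (m - B / 2)) < dist ξ η / 2 := by
    have hlim : Filter.Tendsto (fun m : ℕ => Real.exp (-a * ((m : ℝ) - B / 2))) Filter.atTop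
        (nhds 0) := by
      apply Real.tendsto_exp_atBot.comp
      apply Filter.Tendsto.const_mul_atTop_of_neg (neg_lt_zero.2 ha.1)
      exact Filter.tendsto_atTop_add_const_right _ _ tendsto_natCast_atTop_atTop
    exact (hlim.eventually (gt_mem_nhds (half_pos hd))).exists
  -- Half the separation of distinct classes, so `e`-balls around vertices of different classes are
  -- disjoint.
  set e : ℝ := Real.exp (-a * m) / 4 with he
  have he0 : 0 < e := by positivity
  have hdense : ∀ (ζ : UniformSpace.Completion (HypSpace A.graph A.root a)) (s : ℝ), 0 < s →
      ∃ x : HypSpace A.graph A.root a, dist ζ x < s := fun ζ s hs =>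
    Metric.mem_closure_range_iff.1 (UniformSpace.Completion.denseRange_coe ζ) s hs
  obtain ⟨x, hx⟩ := hdense ξ (min e (dist ξ η / 4)) (lt_min he0 (by positivity))
  obtain ⟨y, hy⟩ := hdense η (min e (dist ξ η / 4)) (lt_min he0 (by positivity))
  rw [lt_min_iff] at hx hy
  have hxm := le_level_of_dist_lt ha (ht hξ) hx.1
  -- Otherwise `dist ξ η` would be less than a quarter, a quarter and a half of itself added up.
  have hxy : ¬ A.Related m x y := by
    intro h
    have h1 := h.hypSpace_dist_le hB ha.1
    rw [← UniformSpace.Completion.dist_eq] at h1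
    have h2 := dist_triangle4_right ξ η
      (x : UniformSpace.Completion (HypSpace A.graph A.root a)) y
    linarith [hx.2, hy.2]
  -- The `e`-balls around the class of `x` and those around all other vertices cover the completion
  -- by density.
  obtain ⟨ζ, -, hζ₁, hζ₂⟩ := hconn
    (⋃ z ∈ {z : HypSpace A.graph A.root a | A.Related m x z},
      Metric.ball (z : UniformSpace.Completion (HypSpace A.graph A.root a)) e)
    (⋃ z ∈ {z : HypSpace A.graph A.root a | ¬ A.Related m x z},
      Metric.ball (z : UniformSpace.Completion (HypSpace A.graph A.root a)) e)
    (isOpen_biUnion fun _ _ => Metric.isOpen_ball) (isOpen_biUnion fun _ _ => Metric.isOpen_ball)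
    (fun ζ _ => by
      obtain ⟨z, hz⟩ := hdense ζ e he0
      by_cases h : A.Related m x z
      · exact Or.inl (Set.mem_biUnion (Set.mem_ofPred.2 h) hz)
      · exact Or.inr (Set.mem_biUnion (Set.mem_ofPred.2 h) hz))
    ⟨ξ, hξ, Set.mem_biUnion (Set.mem_ofPred.2 (.refl hxm)) hx.1⟩
    ⟨η, hη, Set.mem_biUnion (Set.mem_ofPred.2 hxy) hy.1⟩
  simp only [Set.mem_iUnion, Set.mem_ofPred_eq, exists_prop] at hζ₁ hζ₂
  obtain ⟨u, hu, hζu⟩ := hζ₁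
  obtain ⟨v, hv, hζv⟩ := hζ₂
  have huv : u ≠ v := by rintro rfl; exact hv hu
  have h1 := le_dist_of_not_related ha huv fun h => hv (hu.trans h)
  rw [← UniformSpace.Completion.dist_eq] at h1
  have h2 := dist_triangle_left (u : UniformSpace.Completion (HypSpace A.graph A.root a)) v ζ
  rw [Metric.mem_ball] at hζu hζv
  linarith

end TreeAugmentation

/-! ### Levels and parents in a Moran structure. -/

namespace MoranStructure

variable {d : ℕ} (M : MoranStructure d)

theorem ratioProd_pos (k : ℕ) : 0 < M.ratioProd k := Finset.prod_pos fun j _ => M.r_pos j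

theorem ratioProd_succ (k : ℕ) : M.ratioProd (k + 1) = M.ratioProd k * M.r k :=
  Finset.prod_range_succ _ _

theorem ratioProd_antitone : Antitone M.ratioProd :=
  antitone_nat_of_succ_le fun k => by
    rw [ratioProd_succ]
    exact mul_le_of_le_one_right (M.ratioProd_pos k).le (M.r_lt_one k).le

theorem ratioProd_le (k : ℕ) : M.ratioProd k ≤ (1 / 2) ^ k := by
  have h : ∀ j, M.r j ≤ 1 / 2 := fun j => by
    have h1 := M.n_mul_r_le_one j
    have h2 : (2 : ℝ) ≤ M.n j := by exact_mod_cast M.two_le_n j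
    nlinarith [M.r_pos j]
  calc M.ratioProd k ≤ ∏ _j ∈ Finset.range k, (1 / 2 : ℝ) :=
        Finset.prod_le_prod (fun j _ => (M.r_pos j).le) fun j _ => h j
    _ = (1 / 2) ^ k := by simp

theorem rInf_le (k : ℕ) : M.rInf ≤ M.r k :=
  ciInf_le ⟨0, by rintro _ ⟨k, rfl⟩; exact (M.r_pos k).le⟩ k

theorem _root_.IsWord.take {n : ℕ → ℕ} {w : List ℕ} (h : IsWord n w) (k : ℕ) :
    IsWord n (w.take k) := fun j hj => by
  rw [List.getElem_take]
  exact h j (by rw [List.length_take] at hj; omega)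

theorem basic_subset_take {w : List ℕ} (h : IsWord M.n w) (k : ℕ) :
    M.basic w ⊆ M.basic (w.take k) := by
  induction w using List.reverseRecOn with
  | nil => simp
  | append_singleton w i ih =>
    have hw : IsWord M.n w := by simpa using h.take w.length
    have hi : i < M.n w.length := by simpa using h w.length (by simp)
    by_cases hk : k ≤ w.length
    · rw [List.take_append_of_le_length hk]
      exact (M.basic_subset w hw i hi).trans (ih hw)
    · rw [List.take_of_length_le (by simp; omega)]

/-- The index `m` of the level `X_m` that contains `x`. -/
noncomputable def levelIndex (x : M.Vertex) : ℕ := x.2.choose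

theorem mem_level_levelIndex (x : M.Vertex) : x.1 ∈ M.level (M.levelIndex x) := x.2.choose_spec

/-- The words of the level `X_m` are the words of length `K m`, with `K` increasing from `0`. -/
structure IsLevelLength (K : ℕ → ℕ) : Prop where
  strictMono : StrictMono K
  zero : K 0 = 0
  mem_level_iff : ∀ m w, w ∈ M.level m ↔ IsWord M.n w ∧ w.length = K m

/-- The level `X_m` consists of the words of a certain length, which increases with `m`. -/
theorem exists_isLevelLength (hr : 0 < M.rInf) :
    ∃ K, M.IsLevelLength K := by
  classical
  have hlt : M.rInf < 1 := (M.rInf_le 0).trans_lt (M.r_lt_one 0)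
  have hex : ∀ m, ∃ k, M.ratioProd k ≤ M.rInf ^ m := fun m => by
    obtain ⟨k, hk⟩ := exists_pow_lt_of_lt_one (pow_pos hr m) (by norm_num : (1 / 2 : ℝ) < 1)
    exact ⟨k, (M.ratioProd_le k).trans hk.le⟩
  have h0 : Nat.find (hex 0) = 0 := by simp [Nat.find_eq_zero, ratioProd]
  -- `K m` is the first length at which the ratio product drops to `r ^ m`. It is strictly
  -- increasing because one further letter multiplies the product by at least `r`.
  refine ⟨fun m => Nat.find (hex m), strictMono_nat_of_lt_succ fun m => ?_, h0, fun m w => ?_⟩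
  · rw [Nat.lt_find_iff]
    intro j hj
    rw [not_le]
    refine lt_of_lt_of_le ?_ (M.ratioProd_antitone hj)
    rcases hk : Nat.find (hex m) with _ | k
    · have : M.rInf ^ (m + 1) < 1 := pow_lt_one₀ hr.le hlt (Nat.succ_ne_zero m)
      simpa [ratioProd] using this
    · have h := Nat.find_min (hex m) (m := k) (by omega)
      rw [not_le] at h
      rw [ratioProd_succ, pow_succ]
      calc M.rInf ^ m * M.rInf < M.ratioProd k * M.rInf := mul_lt_mul_of_pos_right h hr
        _ ≤ M.ratioProd k * M.r k :=
          mul_le_mul_of_nonneg_left (M.rInf_le k) (M.ratioProd_pos k).le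
  · refine and_congr_right fun _ => ?_
    rw [eq_comm, Nat.find_eq_iff]
    -- `level` tests only the length just below that of `w`; monotonicity extends this to all
    -- shorter lengths.
    refine and_congr_right fun _ => ⟨fun h k hk => ?_, fun h k hk => ?_⟩
    · rw [not_le]
      exact (h (w.length - 1) (by omega)).trans_le (M.ratioProd_antitone (by omega))
    · exact not_le.1 (h k (by omega))

namespace IsLevelLength

variable {M} {K : ℕ → ℕ}

theorem isWord (hK : M.IsLevelLength K) (x : M.Vertex) : IsWord M.n x.1 :=
  ((hK.mem_level_iff _ _).1 (M.mem_level_levelIndex x)).1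

theorem length_eq (hK : M.IsLevelLength K) (x : M.Vertex) : x.1.length = K (M.levelIndex x) :=
  ((hK.mem_level_iff _ _).1 (M.mem_level_levelIndex x)).2

/-- Levels are disjoint since `K` is injective, so the index picked by choice is the only one. -/
theorem levelIndex_eq (hK : M.IsLevelLength K) {x : M.Vertex} {m : ℕ} (h : x.1 ∈ M.level m) :
    M.levelIndex x = m :=
  hK.strictMono.injective ((hK.length_eq x).symm.trans ((hK.mem_level_iff _ _).1 h).2)

theorem take_mem_level (hK : M.IsLevelLength K) (x : M.Vertex) :
    x.1.take (K (M.levelIndex x - 1)) ∈ M.level (M.levelIndex x - 1) := by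
  refine (hK.mem_level_iff _ _).2 ⟨(hK.isWord x).take _, ?_⟩
  rw [List.length_take, hK.length_eq x]
  exact min_eq_left (hK.strictMono.monotone (Nat.sub_le _ _))

/-- The first ancestor of `x`, and the root if `x` is the root. -/
noncomputable def parent (hK : M.IsLevelLength K) (x : M.Vertex) : M.Vertex :=
  ⟨x.1.take (K (M.levelIndex x - 1)), _, hK.take_mem_level x⟩

theorem levelIndex_parent (hK : M.IsLevelLength K) (x : M.Vertex) :
    M.levelIndex (hK.parent x) = M.levelIndex x - 1 :=
  hK.levelIndex_eq (hK.take_mem_level x)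

theorem eq_root (hK : M.IsLevelLength K) {x : M.Vertex} (h : M.levelIndex x = 0) : x = M.root :=
  Subtype.ext (List.eq_nil_of_length_eq_zero (by rw [hK.length_eq, h, hK.zero]))

theorem levelIndex_root (hK : M.IsLevelLength K) : M.levelIndex M.root = 0 :=
  hK.levelIndex_eq ((hK.mem_level_iff _ _).2 ⟨by simp [IsWord, root], by simp [root, hK.zero]⟩)

/-- `hne` excludes the root, which is its own `parent` but not related to itself by `IsParent`. -/
theorem eq_parent_iff (hK : M.IsLevelLength K) {u v : M.Vertex} (hne : u ≠ v) :
    u = hK.parent v ↔ M.IsParent u v := by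
  constructor
  · rintro rfl
    have h0 : M.levelIndex v ≠ 0 := fun h => hne (by
      rw [hK.eq_root h]
      exact hK.eq_root (by rw [hK.levelIndex_parent, hK.levelIndex_root]))
    refine ⟨M.levelIndex v - 1, hK.take_mem_level v, ?_, _, (List.take_append_drop _ _).symm⟩
    rw [Nat.sub_add_cancel (Nat.pos_of_ne_zero h0)]
    exact M.mem_level_levelIndex v
  · rintro ⟨m, hu, hv, s, hs⟩
    apply Subtype.ext
    change u.1 = v.1.take (K (M.levelIndex v - 1))
    rw [hK.levelIndex_eq hv, Nat.add_sub_cancel, ← ((hK.mem_level_iff _ _).1 hu).2, hs,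
      List.take_left]

theorem levelIndex_eq_of_adj (hK : M.IsLevelLength K) {x y : M.Vertex} (h : M.horizontalGraph.Adj x y) :
    M.levelIndex x = M.levelIndex y := by
  obtain ⟨-, m, -, hx, hy, -⟩ := h
  rw [hK.levelIndex_eq hx, hK.levelIndex_eq hy]

theorem reachable_parent (hK : M.IsLevelLength K) {x y : M.Vertex} (h : M.horizontalGraph.Adj x y) :
    M.horizontalGraph.Reachable (hK.parent x) (hK.parent y) := by
  have hl := hK.levelIndex_eq_of_adj h
  obtain ⟨-, -, -, -, -, hne⟩ := h
  by_cases heq : hK.parent x = hK.parent y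
  · rw [heq]
  -- Level 0 carries no horizontal edges, but there both parents are the root.
  by_cases h0 : M.levelIndex x - 1 = 0
  · refine absurd ?_ heq
    rw [hK.eq_root (x := hK.parent x) (by rw [levelIndex_parent, h0]),
      hK.eq_root (x := hK.parent y) (by rw [levelIndex_parent, ← hl, h0])]
  · refine SimpleGraph.Adj.reachable ⟨heq, M.levelIndex x - 1, Nat.pos_of_ne_zero h0,
      hK.take_mem_level x, ?_, ?_⟩
    · rw [hl]
      exact hK.take_mem_level y
    · exact hne.mono (Set.inter_subset_inter (M.basic_subset_take (hK.isWord x) _)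
        (M.basic_subset_take (hK.isWord y) _))

/-- The augmented tree of a Moran structure as a tree with horizontal edges. -/
noncomputable def treeAugmentation (hK : M.IsLevelLength K) : TreeAugmentation M.Vertex where
  root := M.root
  level := M.levelIndex
  parent := hK.parent
  horizontal := M.horizontalGraph
  level_root := hK.levelIndex_root
  eq_root_of_level _ := hK.eq_root
  level_parent := hK.levelIndex_parent
  level_eq_of_adj _ _ := hK.levelIndex_eq_of_adj
  reachable_parent_of_adj _ _ := hK.reachable_parent

theorem graph_treeAugmentation (hK : M.IsLevelLength K) :
    hK.treeAugmentation.graph = M.augmentedTree := by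
  refine congrArg (· ⊔ M.horizontalGraph) ?_
  ext u v
  rw [verticalGraph, SimpleGraph.fromRel_adj, SimpleGraph.fromRel_adj]
  exact and_congr_right fun h => or_congr (hK.eq_parent_iff h) (hK.eq_parent_iff h.symm)

end IsLevelLength

end MoranStructure

theorem corollary4p5 {d : ℕ} (M : MoranStructure d) (hr : 0 < ⨅ k, M.r k)
    (hM : M.Rearrangeable) :
    (∃ δ : ℝ, 0 < δ ∧ IsHyperbolicWith M.augmentedTree M.root δ) ∧
      ∀ a : ℝ, IsAdmissible M.augmentedTree M.root a →
        IsTotallyDisconnected (hyperbolicBoundary M.augmentedTree M.root a) := by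
  obtain ⟨⟨B, hB⟩, -⟩ := hM
  obtain ⟨K, hK⟩ := M.exists_isLevelLength hr
  rw [← hK.graph_treeAugmentation]
  exact ⟨⟨B / 2 + 1, by positivity,
      TreeAugmentation.isHyperbolicWith (A := hK.treeAugmentation) hB⟩,
    fun a ha =>
      TreeAugmentation.isTotallyDisconnected_hyperbolicBoundary (A := hK.treeAugmentation) hB ha⟩
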